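/- Let $\nu$ be a formal variable and let $\Lambda=\begin{bmatrix}0&-1\\1&0\end{bmatrix}$, $E=\begin{bmatrix}1&1\\-1&0\end{bmatrix}$, $B=E^t-E=\begin{bmatrix}0&-2\\2&0\end{bmatrix}$ be the data of $\mathbb P^1$, so that $-\Lambda B=2I_2$. Let $\hat{\mathcal T}_\Lambda$ be the completed quantum torus: its elements are the formal series $\sum_{\alpha\in\mathbb Z^2}c_\alpha X^\alpha$ with $c_\alpha\in\mathbb Z[\nu^{\pm1}]$ whose support $\{\alpha : c_\alpha\neq0\}$ is bounded above for the componentwise order on $\mathbb Z^2$, with the $\mathbb Z[\nu^{\pm1}]$-bilinear product determined by $X^\alpha X^\beta=\nu^{\Lambda(\alpha,\beta)}X^{\alpha+\beta}$, where $\Lambda(\alpha,\beta)=\alpha^t\Lambda\beta$. For $l\in\mathbb Z$ put $$X_{\mathcal O(l)}=X^{-(\begin{smallmatrix}l+1\\-1\end{smallmatrix})}+\sum_{r\ge -l}\nu^{-2(l+r)}[l+r+1]_{\nu^4}\,X^{-(\begin{smallmatrix}l+2r+1\\1\end{smallmatrix})},\qquad [n]_q=\frac{q^n-1}{q-1},$$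 and $X_\delta=X^{-(\begin{smallmatrix}1\\0\end{smallmatrix})}+X^{-(\begin{smallmatrix}-1\\0\end{smallmatrix})}$. The quantum cluster algebra $\mathcal A(\Lambda,B)$ of $\mathbb P^1$ is the $\mathbb Z[\nu^{\pm1}]$-subalgebra of $\hat{\mathcal T}_\Lambda$ generated by the $X_{\mathcal O(l)}$, $l\in\mathbb Z$. Set $$\mathcal B^{vet}=\bigcup_{r\ge1}\{X_{\mathcal O(l)}^{d}X_{\mathcal O(l+1)}^{r-d} : l\in\mathbb Z,\ 1\le d\le r\},\qquad \mathcal B_2^{tor}=\{X_\delta^{n} : n\ge0\}.$$ **Theorem.** The set $\mathcal B^{vet}\cup\mathcal B_2^{tor}$ is contained in $\mathcal A(\Lambda,B)$ and is a basis of $\mathcal A(\Lambda,B)$ as a $\mathbb Z[\nu^{\pm1}]$-module. -/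

import Mathlib

open scoped LaurentPolynomial

namespace QuantumP1

/-- The ground ring `ℤ[ν, ν⁻¹]`; the power `ν ^ n` is `LaurentPolynomial.T n`. -/
abbrev Coeff : Type := ℤ[T;T⁻¹]

/-- Exponent vectors, i.e. the lattice `ℤ²`. -/
abbrev Expo : Type := Fin 2 → ℤ

/-- The matrix `E` of the Euler form on `K₀(Coh ℙ¹)` in the basis (structure sheaf, simple
torsion sheaf of degree one). -/
def eulerMatrix : Matrix (Fin 2) (Fin 2) ℤ := !![1, 1; -1, 0]

/-- The exchange matrix `B = Eᵀ - E`. -/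
def matB : Matrix (Fin 2) (Fin 2) ℤ := eulerMatrix.transpose - eulerMatrix

/-- The skew-symmetric matrix `Λ`. -/
def matLam : Matrix (Fin 2) (Fin 2) ℤ := !![0, -1; 1, 0]

/-- `(Λ, B)` is a compatible pair: `-Λ B = 2 I`. -/
theorem compatible : -(matLam * matB) = 2 • (1 : Matrix (Fin 2) (Fin 2) ℤ) := by
  decide

/-- `α ↦ α^* = Eᵀ α`. -/
def star (α : Expo) : Expo := eulerMatrix.transpose.mulVec α

/-- The exponent `Λ(α^*, β^*)` of `ν` in the product `X^α X^β`. -/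
def twist (α β : Expo) : ℤ := dotProduct (star α) (matLam.mulVec (star β))

/-- As `det E = 1`, the twist is also `Λ(α, β)`. -/
theorem twist_eq (α β : Expo) : twist α β = α 1 * β 0 - α 0 * β 1 := by
  simp [twist, star, matLam, eulerMatrix, Matrix.mulVec, dotProduct, Fin.sum_univ_two,
    Matrix.transpose_apply]
  ring

/-- Formal series `∑ f(α) X^α` over `α ∈ ℤ²` whose support is bounded above for the
componentwise order. With `f₁ = B e₁ = (0, 2)` and `f₂ = B e₂ = (-2, 0)` these are the formal
power series in `X^{-f₁}`, `X^{f₂}` with Laurent polynomials in the `X^α` adjoined. -/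
def seriesModule : Submodule Coeff (Expo → Coeff) where
  carrier := {f | BddAbove (Function.support f)}
  add_mem' := by
    rintro f g ⟨M, hM⟩ ⟨N, hN⟩
    refine ⟨M ⊔ N, fun α hα => ?_⟩
    by_cases hf : f α = 0
    · have hg : g α ≠ 0 := by
        intro hg
        exact hα (by simp [hf, hg])
      exact (hN hg).trans le_sup_right
    · exact (hM hf).trans le_sup_left
  zero_mem' := ⟨0, fun α hα => absurd rfl hα⟩
  smul_mem' := by
    rintro c f ⟨M, hM⟩
    refine ⟨M, fun α hα => hM ?_⟩
    intro hf
    exact hα (by simp [hf])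

/-- The completed quantum torus of `(Λ, B)`. -/
def CompletedTorus : Type := ↥seriesModule

noncomputable instance : AddCommGroup CompletedTorus :=
  inferInstanceAs (AddCommGroup ↥seriesModule)

noncomputable instance : Module Coeff CompletedTorus :=
  inferInstanceAs (Module Coeff ↥seriesModule)

/-- The coefficient of `X^α` in a series. -/
def CompletedTorus.coeff (f : CompletedTorus) (α : Expo) : Coeff := f.1 α

theorem CompletedTorus.bdd (f : CompletedTorus) : BddAbove (Function.support f.coeff) := f.2

/-- The series with given coefficients. -/
def CompletedTorus.mk (f : Expo → Coeff) (hf : BddAbove (Function.support f)) :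
    CompletedTorus := ⟨f, hf⟩

@[ext] theorem CompletedTorus.ext {f g : CompletedTorus} (h : ∀ α, f.coeff α = g.coeff α) :
    f = g := Subtype.ext (funext h)

@[simp] theorem coeff_mk (f : Expo → Coeff) (hf : BddAbove (Function.support f)) (α : Expo) :
    (CompletedTorus.mk f hf).coeff α = f α := rfl

@[simp] theorem coeff_add (f g : CompletedTorus) (α : Expo) :
    (f + g).coeff α = f.coeff α + g.coeff α := rfl

@[simp] theorem coeff_zero (α : Expo) : (0 : CompletedTorus).coeff α = 0 := rfl

@[simp] theorem coeff_smul (c : Coeff) (f : CompletedTorus) (α : Expo) :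
    (c • f).coeff α = c * f.coeff α := rfl

/-- The coefficient of `X^γ` in the product determined by `X^α X^β = ν^{Λ(α^*, β^*)} X^{α+β}`;
only finitely many terms of the sum are non-zero. -/
noncomputable def mulCoeff (f g : Expo → Coeff) (γ : Expo) : Coeff :=
  ∑ᶠ α : Expo, LaurentPolynomial.T (twist α (γ - α)) * f α * g (γ - α)

theorem mulCoeff_eq_sum {f g : Expo → Coeff} {γ : Expo} (s : Finset Expo)
    (hs : ∀ α, f α ≠ 0 → g (γ - α) ≠ 0 → α ∈ s) :
    mulCoeff f g γ = ∑ α ∈ s, LaurentPolynomial.T (twist α (γ - α)) * f α * g (γ - α) := by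
  refine finsum_eq_sum_of_support_subset _ fun α hα => ?_
  refine hs α ?_ ?_ <;> intro h <;> exact hα (by simp [h])

theorem mulCoeff_bdd {f g : Expo → Coeff} (hf : BddAbove (Function.support f))
    (hg : BddAbove (Function.support g)) : BddAbove (Function.support (mulCoeff f g)) := by
  obtain ⟨M, hM⟩ := hf
  obtain ⟨N, hN⟩ := hg
  refine ⟨M + N, fun γ hγ => ?_⟩
  by_contra hc
  apply hγ
  rw [mulCoeff_eq_sum ∅, Finset.sum_empty]
  intro α h1 h2
  exfalso
  apply hc
  have := add_le_add (hM h1) (hN h2)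
  simpa using this

noncomputable instance : Mul CompletedTorus :=
  ⟨fun f g => CompletedTorus.mk (mulCoeff f.coeff g.coeff) (mulCoeff_bdd f.bdd g.bdd)⟩

theorem coeff_mul (f g : CompletedTorus) (γ : Expo) :
    (f * g).coeff γ = mulCoeff f.coeff g.coeff γ := rfl

/-- A convenient finite form of the product. -/
theorem coeff_mul_eq_sum {f g : CompletedTorus} {M N : Expo}
    (hf : M ∈ upperBounds (Function.support f.coeff))
    (hg : N ∈ upperBounds (Function.support g.coeff)) (γ : Expo) (s : Finset Expo)
    (hs : Finset.Icc (γ - N) M ⊆ s) :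
    (f * g).coeff γ =
      ∑ α ∈ s, LaurentPolynomial.T (twist α (γ - α)) * f.coeff α * g.coeff (γ - α) := by
  rw [coeff_mul]
  refine mulCoeff_eq_sum s fun α h1 h2 => hs ?_
  rw [Finset.mem_Icc]
  exact ⟨sub_le_comm.mp (hg h2), hf h1⟩

/-- The monomial `X^α`. -/
noncomputable def monomial (α : Expo) : CompletedTorus :=
  CompletedTorus.mk (Pi.single α 1) ⟨α, fun β hβ => by
    by_contra hc
    apply hβ
    have : β ≠ α := fun h => hc h.le
    simp [this]⟩

theorem coeff_monomial (α β : Expo) :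
    (monomial α).coeff β = (Pi.single α 1 : Expo → Coeff) β := rfl

noncomputable instance : One CompletedTorus := ⟨monomial 0⟩

theorem coeff_one (β : Expo) :
    (1 : CompletedTorus).coeff β = (Pi.single 0 1 : Expo → Coeff) β := rfl

theorem torus_one_mul (f : CompletedTorus) : 1 * f = f := by
  ext1 γ
  rw [coeff_mul, mulCoeff_eq_sum {0}]
  · simp [coeff_one, twist_eq]
  · intro α h1 _
    by_contra hc
    exact h1 (by simpa [coeff_one] using Pi.single_eq_of_ne (by simpa using hc) _)

theorem torus_mul_one (f : CompletedTorus) : f * 1 = f := by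
  ext1 γ
  rw [coeff_mul, mulCoeff_eq_sum {γ}]
  · simp [coeff_one, twist_eq]
  · intro α _ h2
    by_contra hc
    refine h2 (Pi.single_eq_of_ne ?_ _)
    intro h
    exact hc (by simpa using (sub_eq_zero.mp h).symm)

theorem twist_assoc (α γ δ : Expo) :
    twist γ (δ - γ) + twist α (γ - α) =
      twist α (δ - α) + twist (γ - α) (δ - α - (γ - α)) := by
  simp only [twist_eq, Pi.sub_apply]
  ring

theorem torus_mul_assoc (f g h : CompletedTorus) : f * g * h = f * (g * h) := by
  obtain ⟨M, hM⟩ := f.bdd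
  obtain ⟨N, hN⟩ := g.bdd
  obtain ⟨P, hP⟩ := h.bdd
  ext1 δ
  set A : Finset Expo := Finset.Icc (δ - (N + P)) M with hA
  set C : Finset Expo := Finset.Icc (δ - P) (M + N) with hC
  have hfg : ∀ γ, (f * g).coeff γ ≠ 0 → γ ≤ M + N := by
    intro γ hγ
    by_contra hc
    apply hγ
    rw [coeff_mul_eq_sum hM hN γ (Finset.Icc (γ - N) M) subset_rfl]
    rw [Finset.Icc_eq_empty, Finset.sum_empty]
    intro hle
    exact hc (by simpa using hle)
  have hgh : ∀ γ, (g * h).coeff γ ≠ 0 → γ ≤ N + P := by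
    intro γ hγ
    by_contra hc
    apply hγ
    rw [coeff_mul_eq_sum hN hP γ (Finset.Icc (γ - P) N) subset_rfl]
    rw [Finset.Icc_eq_empty, Finset.sum_empty]
    intro hle
    exact hc (by simpa using hle)
  rw [coeff_mul_eq_sum (fun γ hγ => hfg γ hγ) hP δ C subset_rfl,
    coeff_mul_eq_sum hM (fun γ hγ => hgh γ hγ) δ A subset_rfl]
  have e1 : ∀ γ ∈ C, (f * g).coeff γ = ∑ α ∈ A,
      LaurentPolynomial.T (twist α (γ - α)) * f.coeff α * g.coeff (γ - α) := by
    intro γ hγ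
    refine coeff_mul_eq_sum hM hN γ A (Finset.Icc_subset_Icc_left ?_)
    have := (Finset.mem_Icc.mp hγ).1
    have h2 := sub_le_sub_right this N
    rwa [sub_sub, add_comm P N] at h2
  have e2 : ∀ α ∈ A, (g * h).coeff (δ - α) = ∑ γ ∈ C,
      LaurentPolynomial.T (twist (γ - α) (δ - α - (γ - α))) * g.coeff (γ - α) *
        h.coeff (δ - α - (γ - α)) := by
    intro α hα
    rw [coeff_mul_eq_sum hN hP (δ - α) (C.image (fun γ => γ - α)),
      Finset.sum_image (fun x _ y _ hxy => by simpa using hxy)]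
    intro β hβ
    rw [Finset.mem_Icc] at hβ
    refine Finset.mem_image.mpr ⟨β + α, Finset.mem_Icc.mpr ⟨?_, ?_⟩, by simp⟩
    · have := add_le_add_left hβ.1 α
      have h3 : δ - α - P + α = δ - P := by abel
      rwa [h3] at this
    · rw [add_comm M N]
      exact add_le_add hβ.2 (Finset.mem_Icc.mp hα).2
  rw [Finset.sum_congr rfl fun γ hγ => by rw [e1 γ hγ],
    Finset.sum_congr (s₁ := A) rfl fun α hα => by rw [e2 α hα]]
  simp only [Finset.mul_sum, Finset.sum_mul]
  rw [Finset.sum_comm]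
  refine Finset.sum_congr rfl fun α _ => Finset.sum_congr rfl fun γ _ => ?_
  have h3 : δ - α - (γ - α) = δ - γ := by abel
  have key := congrArg (fun n : ℤ => (LaurentPolynomial.T n : Coeff)) (twist_assoc α γ δ)
  simp only [LaurentPolynomial.T_add, h3] at key
  rw [h3]
  linear_combination f.coeff α * g.coeff (γ - α) * h.coeff (δ - γ) * key

theorem torus_left_distrib (f g h : CompletedTorus) : f * (g + h) = f * g + f * h := by
  obtain ⟨M, hM⟩ := f.bdd
  obtain ⟨N, hN⟩ := g.bdd
  obtain ⟨P, hP⟩ := h.bdd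
  obtain ⟨Q, hQ⟩ := (g + h).bdd
  ext1 γ
  rw [coeff_add,
    coeff_mul_eq_sum hM hN γ (Finset.Icc (γ - N) M ∪ Finset.Icc (γ - P) M ∪
      Finset.Icc (γ - Q) M) (fun x hx => by simp only [Finset.mem_union]; tauto),
    coeff_mul_eq_sum hM hP γ (Finset.Icc (γ - N) M ∪ Finset.Icc (γ - P) M ∪
      Finset.Icc (γ - Q) M) (fun x hx => by simp only [Finset.mem_union]; tauto),
    coeff_mul_eq_sum hM hQ γ (Finset.Icc (γ - N) M ∪ Finset.Icc (γ - P) M ∪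
      Finset.Icc (γ - Q) M) (fun x hx => by simp only [Finset.mem_union]; tauto),
    ← Finset.sum_add_distrib]
  refine Finset.sum_congr rfl fun α _ => ?_
  rw [coeff_add, mul_add]

theorem torus_right_distrib (f g h : CompletedTorus) : (f + g) * h = f * h + g * h := by
  obtain ⟨M, hM⟩ := f.bdd
  obtain ⟨N, hN⟩ := g.bdd
  obtain ⟨P, hP⟩ := h.bdd
  obtain ⟨Q, hQ⟩ := (f + g).bdd
  ext1 γ
  rw [coeff_add,
    coeff_mul_eq_sum hM hP γ (Finset.Icc (γ - P) M ∪ Finset.Icc (γ - P) N ∪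
      Finset.Icc (γ - P) Q) (fun x hx => by simp only [Finset.mem_union]; tauto),
    coeff_mul_eq_sum hN hP γ (Finset.Icc (γ - P) M ∪ Finset.Icc (γ - P) N ∪
      Finset.Icc (γ - P) Q) (fun x hx => by simp only [Finset.mem_union]; tauto),
    coeff_mul_eq_sum hQ hP γ (Finset.Icc (γ - P) M ∪ Finset.Icc (γ - P) N ∪
      Finset.Icc (γ - P) Q) (fun x hx => by simp only [Finset.mem_union]; tauto),
    ← Finset.sum_add_distrib]
  refine Finset.sum_congr rfl fun α _ => ?_
  rw [coeff_add, mul_add, add_mul]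

theorem torus_smul_mul (c : Coeff) (f g : CompletedTorus) : (c • f) * g = c • (f * g) := by
  obtain ⟨M, hM⟩ := f.bdd
  obtain ⟨N, hN⟩ := g.bdd
  have hM' : M ∈ upperBounds (Function.support (c • f).coeff) := by
    intro α hα
    refine hM fun h0 => hα ?_
    rw [coeff_smul, h0, mul_zero]
  ext1 γ
  rw [coeff_smul, coeff_mul_eq_sum hM hN γ _ subset_rfl,
    coeff_mul_eq_sum hM' hN γ _ subset_rfl, Finset.mul_sum]
  refine Finset.sum_congr rfl fun α _ => ?_
  rw [coeff_smul]
  ring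

theorem torus_mul_smul (c : Coeff) (f g : CompletedTorus) : f * (c • g) = c • (f * g) := by
  obtain ⟨M, hM⟩ := f.bdd
  obtain ⟨N, hN⟩ := g.bdd
  have hN' : N ∈ upperBounds (Function.support (c • g).coeff) := by
    intro α hα
    refine hN fun h0 => hα ?_
    rw [coeff_smul, h0, mul_zero]
  ext1 γ
  rw [coeff_smul, coeff_mul_eq_sum hM hN γ _ subset_rfl,
    coeff_mul_eq_sum hM hN' γ _ subset_rfl, Finset.mul_sum]
  refine Finset.sum_congr rfl fun α _ => ?_
  rw [coeff_smul]
  ring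

noncomputable instance : Ring CompletedTorus :=
  { (inferInstance : AddCommGroup CompletedTorus) with
    mul := (· * ·)
    one := 1
    one_mul := torus_one_mul
    mul_one := torus_mul_one
    mul_assoc := torus_mul_assoc
    left_distrib := torus_left_distrib
    right_distrib := torus_right_distrib
    zero_mul := fun f => by
      have h := torus_smul_mul 0 0 f
      rwa [zero_smul, zero_smul] at h
    mul_zero := fun f => by
      have h := torus_mul_smul 0 f 0
      rwa [zero_smul, zero_smul] at h }

noncomputable instance : Algebra Coeff CompletedTorus :=
  Algebra.ofModule torus_smul_mul torus_mul_smul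

/-- The quantum integer `[n]_q = (q ^ n - 1) / (q - 1) = 1 + q + ⋯ + q ^ (n - 1)` at
`q = ν ^ 4`. -/
noncomputable def qInt (n : ℕ) : Coeff :=
  ∑ j ∈ Finset.range n, (LaurentPolynomial.T 4 : Coeff) ^ j

/-- Coefficients of the quantum cluster character of `𝒪(l)`,
`X^{-(l+1, -1)} + ∑_{r ≥ -l} ν^{-2(l+r)} [l+r+1]_{ν^4} X^{-(l+2r+1, 1)}`,
with the summation index `k = l + r ≥ 0`. -/
noncomputable def lineBundleCoeff (l : ℤ) (α : Expo) : Coeff :=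
  (Pi.single (-![l + 1, -1]) 1 : Expo → Coeff) α +
    ∑ᶠ k : ℕ, (Pi.single (-![l + 2 * ((k : ℤ) - l) + 1, 1])
      (LaurentPolynomial.T (-2 * (k : ℤ)) * qInt (k + 1)) : Expo → Coeff) α

theorem lineBundleCoeff_bdd (l : ℤ) : BddAbove (Function.support (lineBundleCoeff l)) := by
  refine ⟨![|l| + 1, 1], fun α hα => ?_⟩
  have h : α = -![l + 1, -1] ∨ ∃ k : ℕ, α = -![l + 2 * ((k : ℤ) - l) + 1, 1] := by
    by_contra hc
    push Not at hc
    apply hα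
    have h2 : ∀ k : ℕ, (Pi.single (-![l + 2 * ((k : ℤ) - l) + 1, 1])
        (LaurentPolynomial.T (-2 * (k : ℤ)) * qInt (k + 1)) : Expo → Coeff) α = 0 :=
      fun k => Pi.single_eq_of_ne (hc.2 k) _
    rw [lineBundleCoeff, Pi.single_eq_of_ne hc.1, finsum_congr h2, finsum_zero, add_zero]
  have h1 := neg_abs_le l
  have h2 := le_abs_self l
  rcases h with rfl | ⟨k, rfl⟩ <;> intro i <;> fin_cases i <;> simp <;> omega

/-- The quantum cluster character `X_{𝒪(l)}` of the line bundle `𝒪(l)`. -/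
noncomputable def XO (l : ℤ) : CompletedTorus :=
  CompletedTorus.mk (lineBundleCoeff l) (lineBundleCoeff_bdd l)

/-- `X_δ = X^{-(1, 0)} + X^{-(-1, 0)}`, the quantum cluster character of a simple torsion sheaf
supported at a point of degree one. -/
noncomputable def Xdelta : CompletedTorus := monomial (-![1, 0]) + monomial (-![-1, 0])

/-- The quantum cluster algebra of `ℙ¹`: the `ℤ[ν, ν⁻¹]`-subalgebra of the completed quantum
torus generated by all `X_{𝒪(l)}`, `l ∈ ℤ`. -/
noncomputable def clusterAlgebra : Subalgebra Coeff CompletedTorus :=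
  Algebra.adjoin Coeff (Set.range XO)

/-- `𝒞_r = {X_{𝒪(l)} ^ d X_{𝒪(l+1)} ^ (r - d) : l ∈ ℤ, 1 ≤ d ≤ r}`. -/
def setC (r : ℕ) : Set CompletedTorus :=
  {x | ∃ (l : ℤ) (d : ℕ), 1 ≤ d ∧ d ≤ r ∧ x = XO l ^ d * XO (l + 1) ^ (r - d)}

/-- The union of the sets `𝒞_r` over `r ≥ 1`. -/
def Bvet : Set CompletedTorus := ⋃ r : ℕ, ⋃ _ : 1 ≤ r, setC r

/-- The powers `X_δ ^ n`, `n ≥ 0`. -/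
def Btor : Set CompletedTorus := {x | ∃ n : ℕ, x = Xdelta ^ n}

end QuantumP1

open scoped LaurentPolynomial

namespace QuantumP1

open LaurentPolynomial (T)

/-! Everything follows from three kinds of relations. Multiplication by `Xdelta` on either side
sends `XO l` to a combination of its two neighbours (`Xdelta_mul_XO`, `XO_mul_Xdelta`); neighbours
commute up to a power of ν (`XO_succ_mul_XO`); and the exchange relation `XO_pred_mul_XO_succ`
rewrites a product of second neighbours.

Spanning: multiplying the exchange relation by `Xdelta` shows that `Xdelta` lies in the algebra.
Conversely, the span of the proposed basis contains 1 and is stable under left multiplication by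
`Xdelta` and then by every `XO m`, because the `XO m` satisfy a two-step recursion with coefficient
`Xdelta`. So the span is the whole algebra (`basisSpan_eq`).

Independence: order exponents lexicographically, second coordinate first. Leading exponents add
under multiplication (`HasLead.mul`), and those of the proposed basis are pairwise distinct by
uniqueness of Euclidean division (`basisLead_injective`). -/

/-! ### Products with monomials -/

theorem coeff_monomial_mul (α : Expo) (f : CompletedTorus) (γ : Expo) :
    (monomial α * f).coeff γ = T (twist α (γ - α)) * f.coeff (γ - α) := by
  rw [coeff_mul, mulCoeff_eq_sum {α}]
  · simp [coeff_monomial]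
  · intro β h1 _
    by_contra hc
    exact h1 (by rw [coeff_monomial]; exact Pi.single_eq_of_ne (by simpa using hc) _)

theorem coeff_mul_monomial (f : CompletedTorus) (α γ : Expo) :
    (f * monomial α).coeff γ = T (twist (γ - α) α) * f.coeff (γ - α) := by
  rw [coeff_mul, mulCoeff_eq_sum {γ - α}]
  · simp [coeff_monomial]
  · intro β _ h2
    by_contra hc
    refine h2 ?_
    rw [coeff_monomial]
    refine Pi.single_eq_of_ne (fun h => hc ?_) _
    rw [← h]
    simp

theorem monomial_mul_monomial (α β : Expo) :
    monomial α * monomial β = (T (twist α β) : Coeff) • monomial (α + β) := by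
  ext1 γ
  rw [coeff_monomial_mul, coeff_smul, coeff_monomial, coeff_monomial]
  by_cases h : γ = α + β
  · subst h
    simp
  · rw [Pi.single_eq_of_ne h, Pi.single_eq_of_ne (fun h' => h (by rw [← h']; simp)), mul_zero,
      mul_zero]

/-! ### Series supported on a horizontal ray -/

/-- The series `∑ a k X^(m - 2 k, b)` over `k ≥ 0`. -/
noncomputable def ser (a : ℕ → Coeff) (m b : ℤ) : CompletedTorus :=
  CompletedTorus.mk
    (fun γ => if γ 1 = b ∧ γ 0 ≤ m ∧ 2 ∣ m - γ 0 then a ((m - γ 0) / 2).toNat else 0)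
    ⟨![m, b], fun γ hγ => by
      rw [Function.mem_support, ne_eq, ite_eq_right_iff, Classical.not_imp] at hγ
      intro i
      fin_cases i
      · exact hγ.1.2.1
      · exact hγ.1.1.le⟩

theorem coeff_ser (a : ℕ → Coeff) (m b : ℤ) (γ : Expo) :
    (ser a m b).coeff γ =
      if γ 1 = b ∧ γ 0 ≤ m ∧ 2 ∣ m - γ 0 then a ((m - γ 0) / 2).toNat else 0 := rfl

theorem coeff_ser_apply (a : ℕ → Coeff) (m b : ℤ) (k : ℕ) :
    (ser a m b).coeff ![m - 2 * k, b] = a k := by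
  simp [coeff_ser]

theorem coeff_ser_ne (a : ℕ → Coeff) (m b : ℤ) (γ : Expo)
    (h : ∀ k : ℕ, γ ≠ ![m - 2 * k, b]) : (ser a m b).coeff γ = 0 := by
  rw [coeff_ser, if_neg]
  rintro ⟨h1, h2, k, hk⟩
  refine h k.toNat ?_
  ext i
  fin_cases i
  · simp
    omega
  · simpa using h1

/-- A series equals `ser a m b` as soon as its coefficients at the exponents `(m - 2 k, b)` are
`a k` and it vanishes elsewhere. -/
theorem eq_ser {f : CompletedTorus} {a : ℕ → Coeff} {m b : ℤ}
    (h : ∀ k : ℕ, f.coeff ![m - 2 * k, b] = a k)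
    (h0 : ∀ γ : Expo, (∀ k : ℕ, γ ≠ ![m - 2 * k, b]) → f.coeff γ = 0) : f = ser a m b := by
  ext1 γ
  by_cases hγ : ∃ k : ℕ, γ = ![m - 2 * k, b]
  · obtain ⟨k, rfl⟩ := hγ
    rw [h, coeff_ser_apply]
  · push Not at hγ
    rw [h0 γ hγ, coeff_ser_ne _ _ _ _ hγ]

theorem ser_add (a a' : ℕ → Coeff) (m b : ℤ) :
    ser a m b + ser a' m b = ser (fun k => a k + a' k) m b :=
  eq_ser (fun k => by simp only [coeff_add, coeff_ser_apply])
    (fun γ h => by simp only [coeff_add, coeff_ser_ne _ _ _ _ h, add_zero])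

theorem smul_ser (c : Coeff) (a : ℕ → Coeff) (m b : ℤ) :
    c • ser a m b = ser (fun k => c * a k) m b :=
  eq_ser (fun k => by simp only [coeff_smul, coeff_ser_apply])
    (fun γ h => by simp only [coeff_smul, coeff_ser_ne _ _ _ _ h, mul_zero])

theorem monomial_mul_ser (c d : ℤ) (a : ℕ → Coeff) (m b : ℤ) :
    monomial ![c, d] * ser a m b =
      ser (fun k => T (d * (m - 2 * k) - c * b) * a k) (m + c) (b + d) := by
  refine eq_ser (fun k => ?_) (fun γ h => ?_)
  · have e : (![m + c - 2 * k, b + d] - ![c, d] : Expo) = ![m - 2 * k, b] := by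
      ext i
      fin_cases i <;> simp
      ring
    rw [coeff_monomial_mul, e, coeff_ser_apply, twist_eq]
    simp
  · rw [coeff_monomial_mul, coeff_ser_ne, mul_zero]
    intro k hk
    refine h k ?_
    rw [sub_eq_iff_eq_add] at hk
    rw [hk]
    ext i
    fin_cases i <;> simp
    ring

theorem ser_mul_monomial (c d : ℤ) (a : ℕ → Coeff) (m b : ℤ) :
    ser a m b * monomial ![c, d] =
      ser (fun k => T (b * c - (m - 2 * k) * d) * a k) (m + c) (b + d) := by
  refine eq_ser (fun k => ?_) (fun γ h => ?_)
  · have e : (![m + c - 2 * k, b + d] - ![c, d] : Expo) = ![m - 2 * k, b] := by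
      ext i
      fin_cases i <;> simp
      ring
    rw [coeff_mul_monomial, e, coeff_ser_apply, twist_eq]
    simp
  · rw [coeff_mul_monomial, coeff_ser_ne, mul_zero]
    intro k hk
    refine h k ?_
    rw [sub_eq_iff_eq_add] at hk
    rw [hk]
    ext i
    fin_cases i <;> simp
    ring

/-- Splitting off the top term lets series with different starting exponents be aligned and compared
coefficientwise. -/
theorem ser_eq_monomial_add (a : ℕ → Coeff) (m b : ℤ) :
    ser a m b = a 0 • monomial ![m, b] + ser (fun k => a (k + 1)) (m - 2) b := by
  symm
  refine eq_ser (fun k => ?_) (fun γ h => ?_)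
  · rw [coeff_add, coeff_smul, coeff_monomial]
    rcases k with _ | k
    · rw [coeff_ser_ne]
      · simp
      · intro k hk
        have := congrFun hk 0
        simp at this
        omega
    · have e : (![m - 2 * ((k + 1 : ℕ) : ℤ), b] : Expo) = ![m - 2 - 2 * k, b] := by
        ext i
        fin_cases i <;> simp
        ring
      rw [e, coeff_ser_apply, Pi.single_eq_of_ne, mul_zero, zero_add]
      intro hk
      have := congrFun hk 0
      simp at this
      omega
  · rw [coeff_add, coeff_smul, coeff_monomial, Pi.single_eq_of_ne, coeff_ser_ne, mul_zero,
      add_zero]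
    · intro k hk
      refine h (k + 1) ?_
      rw [hk]
      ext i
      fin_cases i <;> simp
      ring
    · simpa using h 0

/-! ### Symmetric quantum integers -/

/-- The symmetric quantum integer `[k + 1]` at `ν ^ 2`. -/
noncomputable def qSym (k : ℕ) : Coeff := T (-2 * (k : ℤ)) * qInt (k + 1)

theorem qSym_zero : qSym 0 = 1 := by
  simp [qSym, qInt]

/-- This recursion peels off the highest power of ν; its mirror `qSym_succ'` peels off the lowest.
Together they express both extreme powers through two consecutive quantum integers. -/
theorem qSym_succ (k : ℕ) : qSym (k + 1) = T (-2) * qSym k + T (2 * k + 2) := by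
  simp only [qSym, qInt, Finset.sum_range_succ _ (k + 1), mul_add, ← mul_assoc,
    LaurentPolynomial.T_pow, ← LaurentPolynomial.T_add]
  congr 1
  · congr 2
    push_cast
    ring
  · congr 1
    push_cast
    ring

theorem qSym_succ' (k : ℕ) : qSym (k + 1) = T 2 * qSym k + T (-2 * k - 2) := by
  simp only [qSym, qInt, Finset.sum_range_succ' _ (k + 1), mul_add,
    LaurentPolynomial.T_pow, Finset.mul_sum, ← LaurentPolynomial.T_add]
  congr 1
  · refine Finset.sum_congr rfl fun j _ => ?_
    congr 1
    push_cast
    ring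
  · congr 1
    push_cast
    ring

/-! ### Relations between the line bundle characters and `Xdelta` -/

theorem XO_eq (l : ℤ) : XO l = monomial ![-(l + 1), 1] + ser qSym (l - 1) (-1) := by
  have e1 : (-![l + 1, -1] : Expo) = ![-(l + 1), 1] := by
    ext i
    fin_cases i <;> simp
  have e2 : ∀ k : ℕ, (-![l + 2 * ((k : ℤ) - l) + 1, 1] : Expo) = ![l - 1 - 2 * k, -1] := by
    intro k
    ext i
    fin_cases i <;> simp
    ring
  ext1 γ
  rw [coeff_add]
  change lineBundleCoeff l γ = _
  rw [lineBundleCoeff, e1, coeff_monomial]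
  congr 1
  simp only [e2]
  change ∑ᶠ k : ℕ, (Pi.single _ (qSym k) : Expo → Coeff) γ = _
  by_cases hγ : ∃ k : ℕ, γ = ![l - 1 - 2 * k, -1]
  · obtain ⟨k, rfl⟩ := hγ
    rw [coeff_ser_apply, finsum_eq_single _ k, Pi.single_eq_same]
    intro j hj
    refine Pi.single_eq_of_ne (fun h => hj ?_) _
    have := congrFun h 0
    simp at this
    omega
  · push Not at hγ
    rw [coeff_ser_ne _ _ _ _ hγ]
    have h0 : ∀ k : ℕ, (Pi.single ![l - 1 - 2 * (k : ℤ), -1] (qSym k) : Expo → Coeff) γ = 0 :=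
      fun k => Pi.single_eq_of_ne (hγ k) _
    rw [finsum_congr h0, finsum_zero]

theorem Xdelta_eq : Xdelta = monomial ![-1, 0] + monomial ![1, 0] := by
  rw [Xdelta]
  congr 2 <;> ext i <;> fin_cases i <;> simp

theorem one_eq_monomial : (1 : CompletedTorus) = monomial ![0, 0] := by
  change monomial 0 = _
  congr 1
  ext i
  fin_cases i <;> rfl

theorem monomial_mul_monomial' (a b c d : ℤ) :
    monomial ![a, b] * monomial ![c, d] =
      (T (b * c - a * d) : Coeff) • monomial ![a + c, b + d] := by
  rw [monomial_mul_monomial, twist_eq]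
  simp

/-- The summand X^(-1,0) moves the monomial of `XO l` to that of `XO (l + 1)` and the tail to that
of `XO (l - 1)`; the summand X^(1,0) does the opposite. The twists match because the two parts lie
in rows 1 and -1. -/
theorem Xdelta_mul_XO (l : ℤ) :
    Xdelta * XO l = (T 1 : Coeff) • XO (l + 1) + (T (-1) : Coeff) • XO (l - 1) := by
  simp only [XO_eq, Xdelta_eq, add_mul, mul_add, monomial_mul_monomial', monomial_mul_ser,
    smul_add, smul_ser]
  ring_nf
  abel

theorem XO_mul_Xdelta (l : ℤ) :
    XO l * Xdelta = (T (-1) : Coeff) • XO (l + 1) + (T 1 : Coeff) • XO (l - 1) := by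
  simp only [XO_eq, Xdelta_eq, add_mul, mul_add, monomial_mul_monomial', ser_mul_monomial,
    smul_add, smul_ser]
  ring_nf
  abel

/-- A factor X^(-1,0) placed between the two series can be absorbed by either one. This compares
products of tails without computing any convolution. -/
theorem ser_mul_ser_shift (l m : ℤ) :
    ser qSym l (-1) * ser qSym m (-1) =
      (T 2 : Coeff) • (ser qSym (l - 1) (-1) * ser qSym (m + 1) (-1)) := by
  have h1 : ser qSym l (-1) * monomial ![-1, 0] = (T 1 : Coeff) • ser qSym (l - 1) (-1) := by
    rw [ser_mul_monomial, smul_ser]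
    ring_nf
  have h2 : monomial ![-1, 0] * ser qSym (m + 1) (-1) = (T (-1) : Coeff) • ser qSym m (-1) := by
    rw [monomial_mul_ser, smul_ser]
    ring_nf
  have h3 := congrArg (fun t => (T 1 : Coeff) • (ser qSym l (-1) * t)) h2
  simp only [← mul_assoc, h1, smul_mul_assoc, mul_smul_comm, smul_smul,
    ← LaurentPolynomial.T_add] at h3
  simpa using h3.symm

/-- The product is sorted by rows 2, 0 and -2. In the relations below both sides have the same `l +
m`, so the top monomials agree up to a power of ν and the bottom row is settled by
`ser_mul_ser_shift`; only the row 0 cross terms need an argument. -/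
theorem XO_mul_XO (l m : ℤ) :
    XO l * XO m = (T (l - m) : Coeff) • monomial ![-l - m - 2, 2] +
      (ser (fun k => T (m - l - 2 * k - 2) * qSym k) (m - l - 2) 0 +
        ser (fun k => T (m - l + 2 * k + 2) * qSym k) (l - m - 2) 0) +
      ser qSym (l - 1) (-1) * ser qSym (m - 1) (-1) := by
  simp only [XO_eq, add_mul, mul_add, monomial_mul_monomial', monomial_mul_ser, ser_mul_monomial]
  ring_nf
  abel

theorem T_mul_T_neg (n : ℤ) : (T n : Coeff) * T (-n) = 1 := by
  rw [← LaurentPolynomial.T_add, add_neg_cancel, LaurentPolynomial.T_zero]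

theorem T_split (a b n : ℤ) (h : n = a + b) : (T n : Coeff) = T a * T b := by
  rw [h, LaurentPolynomial.T_add]

theorem cross_terms_succ :
    ser (fun k => T (-3 - 2 * k) * qSym k) (-3) 0 + ser (fun k => T (1 + 2 * k) * qSym k) (-1) 0 =
      (T 2 : Coeff) • (ser (fun k => T (-1 - 2 * k) * qSym k) (-1) 0 +
        ser (fun k => T (3 + 2 * k) * qSym k) (-3) 0) := by
  have key : ∀ k : ℕ, T (-3 - 2 * k) * qSym k + T (1 + 2 * (k + 1 : ℕ)) * qSym (k + 1) =
      T 2 * (T (-1 - 2 * (k + 1 : ℕ)) * qSym (k + 1) + T (3 + 2 * k) * qSym k) := by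
    intro k
    have h1 := qSym_succ k
    have h2 := qSym_succ' k
    have e := T_mul_T_neg 1
    rw [T_split (-1) (-1) (-2) (by norm_num)] at h1
    rw [T_split 1 1 2 (by norm_num)] at h2 ⊢
    rw [T_split (-1) (-2 * k - 2) (-3 - 2 * k) (by ring),
      T_split (-1) (-2 * k - 2) (-1 - 2 * (k + 1 : ℕ)) (by push_cast; ring),
      T_split 1 (2 * k + 2) (1 + 2 * (k + 1 : ℕ)) (by push_cast; ring),
      T_split 1 (2 * k + 2) (3 + 2 * k) (by ring)]
    generalize (T 1 : Coeff) = v at *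
    generalize (T (-1) : Coeff) = w at *
    generalize (T (2 * k + 2) : Coeff) = a at *
    generalize (T (-2 * k - 2) : Coeff) = b at *
    generalize qSym (k + 1) = c' at *
    generalize qSym k = c at *
    -- Eliminating ν^(2k+2) and ν^(-2k-2) by the two recursions leaves a polynomial identity in ν,
    -- ν⁻¹ and two quantum integers, valid modulo ν ν⁻¹ = 1.
    obtain rfl : a = c' - w * w * c := by linear_combination -h1
    obtain rfl : b = c' - v * v * c := by linear_combination -h2
    linear_combination (-w * c * c' + v ^ 2 * w * c ^ 2 - v * c' ^ 2 + v ^ 3 * c * c') * e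
  have hs := congrArg (fun a => ser a (-3) 0) (funext key)
  simp only [← ser_add, ← smul_ser] at hs
  have e : (-1 - 2 : ℤ) = -3 := by norm_num
  rw [ser_eq_monomial_add _ (-1), ser_eq_monomial_add _ (-1), e, add_left_comm, hs]
  simp only [Nat.cast_zero, qSym_zero, smul_add, smul_smul, mul_one, mul_zero, add_zero, sub_zero,
    ← LaurentPolynomial.T_add]
  norm_num
  abel

theorem cross_terms_pred :
    ser (fun k => T (-2 * k) * qSym k) 0 0 + ser (fun k => T (4 + 2 * k) * qSym k) (-4) 0 =
      (T (-2) : Coeff) • (ser (fun k => T (-2 - 2 * k) * qSym k) (-2) 0 +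
        ser (fun k => T (2 + 2 * k) * qSym k) (-2) 0) + 1 := by
  have key : ∀ k : ℕ, T (-2 * (k + 1 + 1 : ℕ)) * qSym (k + 1 + 1) + T (4 + 2 * k) * qSym k =
      T (-2) * (T (-2 - 2 * (k + 1 : ℕ)) * qSym (k + 1) +
        T (2 + 2 * (k + 1 : ℕ)) * qSym (k + 1)) := by
    intro k
    have h1 := qSym_succ (k + 1)
    have h2 := qSym_succ' k
    have e := T_mul_T_neg 2
    have e' := T_mul_T_neg (2 * k + 4)
    rw [show 2 * ((k + 1 : ℕ) : ℤ) + 2 = 2 * k + 4 by push_cast; ring] at h1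
    rw [T_split 2 (-(2 * k + 4)) (-2 * k - 2) (by ring)] at h2
    rw [show -2 * ((k + 1 + 1 : ℕ) : ℤ) = -(2 * k + 4) by push_cast; ring,
      show -2 - 2 * ((k + 1 : ℕ) : ℤ) = -(2 * k + 4) by push_cast; ring,
      show 2 + 2 * ((k + 1 : ℕ) : ℤ) = 2 * k + 4 by push_cast; ring, add_comm 4 (2 * (k : ℤ))]
    linear_combination (T (-(2 * k + 4)) : Coeff) * h1 - T (-2) * T (2 * k + 4) * h2 -
      (T (2 * k + 4) * qSym k + T (2 * k + 4) * T (-(2 * k + 4))) * e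
  have hs := congrArg (fun a => ser a (-4) 0) (funext key)
  simp only [← ser_add, ← smul_ser] at hs
  have e2 : (0 - 2 : ℤ) = -2 := by norm_num
  have e4 : (-2 - 2 : ℤ) = -4 := by norm_num
  -- The coefficients at X^(0,0) and X^(-2,0) fall outside `key`; the first one is the summand 1 of
  -- the exchange relation.
  rw [ser_eq_monomial_add _ 0, e2]
  simp only [ser_eq_monomial_add _ (-2), e4]
  rw [add_assoc, add_assoc, hs, one_eq_monomial, qSym_succ 0]
  simp only [Nat.cast_zero, Nat.cast_add, Nat.cast_one, qSym_zero, smul_add, smul_smul, mul_one,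
    mul_zero, add_zero, sub_zero, zero_add, mul_add, add_smul, ← LaurentPolynomial.T_add]
  norm_num
  abel

theorem XO_succ_mul_XO (l : ℤ) : XO (l + 1) * XO l = (T 2 : Coeff) • (XO l * XO (l + 1)) := by
  have h := cross_terms_succ
  rw [XO_mul_XO, XO_mul_XO, ser_mul_ser_shift (l + 1 - 1) (l - 1), smul_add, smul_add, smul_smul,
    ← LaurentPolynomial.T_add]
  ring_nf at h ⊢
  rw [h]

theorem XO_pred_mul_XO_succ (l : ℤ) :
    XO (l - 1) * XO (l + 1) = (T (-2) : Coeff) • XO l ^ 2 + 1 := by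
  have h := cross_terms_pred
  rw [pow_two, XO_mul_XO, XO_mul_XO, ser_mul_ser_shift (l - 1) (l - 1), smul_add, smul_add,
    smul_smul, smul_smul, ← LaurentPolynomial.T_add, ← LaurentPolynomial.T_add]
  ring_nf at h ⊢
  rw [h]
  simp
  abel

theorem XO_succ_mul_XO_pow (l : ℤ) (n : ℕ) :
    XO (l + 1) * XO l ^ n = (T (2 * n) : Coeff) • (XO l ^ n * XO (l + 1)) := by
  induction n with
  | zero => simp
  | succ n ih =>
    rw [pow_succ, ← mul_assoc, ih, smul_mul_assoc, mul_assoc, XO_succ_mul_XO, mul_smul_comm,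
      smul_smul, ← LaurentPolynomial.T_add, mul_assoc]
    push_cast
    rw [mul_add, mul_one]

theorem XO_mul_XO_succ (l : ℤ) : XO l * XO (l + 1) = (T (-2) : Coeff) • (XO (l + 1) * XO l) := by
  rw [XO_succ_mul_XO, smul_smul, ← LaurentPolynomial.T_add]
  simp

theorem XO_mul_XO_succ_pow (l : ℤ) (n : ℕ) :
    XO l * XO (l + 1) ^ n = (T (-2 * n) : Coeff) • (XO (l + 1) ^ n * XO l) := by
  induction n with
  | zero => simp
  | succ n ih =>
    rw [pow_succ, ← mul_assoc, ih, smul_mul_assoc, mul_assoc, XO_mul_XO_succ, mul_smul_comm,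
      smul_smul, ← LaurentPolynomial.T_add, mul_assoc]
    push_cast
    rw [mul_add, mul_one]

/-! ### The span of the proposed basis is the whole algebra -/

theorem Xdelta_mem : Xdelta ∈ clusterAlgebra := by
  have hX : ∀ l, XO l ∈ clusterAlgebra := fun l => Algebra.subset_adjoin ⟨l, rfl⟩
  -- The constant 1 of the exchange relation becomes `Xdelta`; in all other terms `Xdelta` is
  -- absorbed into a neighbouring `XO`.
  have h := congrArg (fun t => Xdelta * t) (XO_pred_mul_XO_succ 0)
  simp only [mul_add, mul_one, mul_smul_comm, pow_two, ← mul_assoc, Xdelta_mul_XO] at h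
  rw [← sub_eq_iff_eq_add'] at h
  rw [← h]
  have hs : ∀ (c : Coeff) l, c • XO l ∈ clusterAlgebra :=
    fun c l => clusterAlgebra.smul_mem (hX l) c
  exact sub_mem (mul_mem (add_mem (hs _ _) (hs _ _)) (hX _))
    (clusterAlgebra.smul_mem (mul_mem (add_mem (hs _ _) (hs _ _)) (hX _)) _)

/-- The span of cluster monomials and powers of `X_δ`. -/
noncomputable def basisSpan : Submodule Coeff CompletedTorus := Submodule.span Coeff (Bvet ∪ Btor)

theorem Xdelta_pow_mem_basisSpan (n : ℕ) : Xdelta ^ n ∈ basisSpan :=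
  Submodule.subset_span (Or.inr ⟨n, rfl⟩)

theorem XO_pow_mul_XO_pow_mem_Bvet (l : ℤ) (d e : ℕ) : XO l ^ (d + 1) * XO (l + 1) ^ e ∈ Bvet := by
  refine Set.mem_iUnion₂.mpr ⟨d + 1 + e, by omega, l, d + 1, by omega, by omega, ?_⟩
  rw [Nat.add_sub_cancel_left]

theorem XO_pow_mul_XO_pow_mem (l : ℤ) (d e : ℕ) : XO l ^ d * XO (l + 1) ^ e ∈ basisSpan := by
  rcases d with _ | d
  · rcases e with _ | e
    · simpa using Xdelta_pow_mem_basisSpan 0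
    · have := XO_pow_mul_XO_pow_mem_Bvet (l + 1) e 0
      rw [pow_zero, mul_one] at this
      rw [pow_zero, one_mul]
      exact Submodule.subset_span (Or.inl this)
  · exact Submodule.subset_span (Or.inl (XO_pow_mul_XO_pow_mem_Bvet l d e))

theorem Xdelta_mul_mem {x : CompletedTorus} (hx : x ∈ basisSpan) : Xdelta * x ∈ basisSpan := by
  induction hx using Submodule.span_induction with
  | zero => rw [mul_zero]; exact zero_mem _
  | add x y _ _ hx hy => rw [mul_add]; exact add_mem hx hy
  | smul c x _ hx => rw [mul_smul_comm]; exact basisSpan.smul_mem c hx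
  | mem x hx =>
    rcases hx with hx | ⟨n, rfl⟩
    · obtain ⟨r, -, l, d, hd, -, rfl⟩ := Set.mem_iUnion₂.mp hx
      generalize r - d = e
      obtain ⟨d, rfl⟩ := Nat.exists_eq_add_of_le' hd
      rw [pow_succ', ← mul_assoc, ← mul_assoc, Xdelta_mul_XO, add_mul, add_mul, smul_mul_assoc,
        smul_mul_assoc, smul_mul_assoc, smul_mul_assoc]
      refine add_mem (basisSpan.smul_mem _ ?_) (basisSpan.smul_mem _ ?_)
      · rw [XO_succ_mul_XO_pow, smul_mul_assoc, mul_assoc, ← pow_succ']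
        exact basisSpan.smul_mem _ (XO_pow_mul_XO_pow_mem l d (e + 1))
      -- For `e = 0` the term is already a cluster monomial. Otherwise `XO (l - 1)` is moved past
      -- the powers of `XO l` to meet a factor `XO (l + 1)`, where the exchange relation applies.
      · rcases e with _ | e
        · simpa using XO_pow_mul_XO_pow_mem (l - 1) 1 d
        · have h := XO_mul_XO_succ_pow (l - 1) d
          rw [sub_add_cancel] at h
          rw [h, smul_mul_assoc, pow_succ', mul_assoc, ← mul_assoc (XO (l - 1)),
            XO_pred_mul_XO_succ, add_mul, one_mul, mul_add, smul_mul_assoc, mul_smul_comm,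
            ← mul_assoc, ← pow_add]
          exact basisSpan.smul_mem _ (add_mem (basisSpan.smul_mem _
            (XO_pow_mul_XO_pow_mem l (d + 2) e)) (XO_pow_mul_XO_pow_mem l d e))
    · rw [← pow_succ']
      exact Xdelta_pow_mem_basisSpan (n + 1)

theorem XO_mul_Xdelta_pow_mem (m : ℤ) (n : ℕ) : XO m * Xdelta ^ n ∈ basisSpan := by
  induction n generalizing m with
  | zero => simpa using XO_pow_mul_XO_pow_mem m 1 0
  | succ n ih =>
    rw [pow_succ', ← mul_assoc, XO_mul_Xdelta, add_mul, smul_mul_assoc, smul_mul_assoc]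
    exact add_mem (basisSpan.smul_mem _ (ih _)) (basisSpan.smul_mem _ (ih _))

theorem XO_succ_eq (m : ℤ) :
    XO (m + 1) = (T (-1) : Coeff) • (Xdelta * XO m) - (T (-2) : Coeff) • XO (m - 1) := by
  rw [Xdelta_mul_XO, smul_add, smul_smul, smul_smul, ← LaurentPolynomial.T_add,
    ← LaurentPolynomial.T_add]
  simp

theorem XO_pred_eq (m : ℤ) :
    XO (m - 1) = (T 1 : Coeff) • (Xdelta * XO m) - (T 2 : Coeff) • XO (m + 1) := by
  rw [Xdelta_mul_XO, smul_add, smul_smul, smul_smul, ← LaurentPolynomial.T_add,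
    ← LaurentPolynomial.T_add]
  simp

/-- Two consecutive `X_{𝒪(l)}` suffice to test membership, since the span is stable under
multiplication by `X_δ`. -/
theorem XO_mul_mem_of_consecutive {x : CompletedTorus} {l : ℤ} (h0 : XO l * x ∈ basisSpan)
    (h1 : XO (l + 1) * x ∈ basisSpan) (m : ℤ) : XO m * x ∈ basisSpan := by
  suffices h : XO m * x ∈ basisSpan ∧ XO (m + 1) * x ∈ basisSpan from h.1
  induction m using Int.inductionOn' (b := l) with
  | zero => exact ⟨h0, h1⟩
  | succ k _ ih =>
    refine ⟨ih.2, ?_⟩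
    rw [XO_succ_eq, sub_mul, smul_mul_assoc, smul_mul_assoc, mul_assoc, add_sub_cancel_right]
    exact sub_mem (basisSpan.smul_mem _ (Xdelta_mul_mem ih.2)) (basisSpan.smul_mem _ ih.1)
  | pred k _ ih =>
    rw [sub_add_cancel]
    refine ⟨?_, ih.1⟩
    rw [XO_pred_eq, sub_mul, smul_mul_assoc, smul_mul_assoc, mul_assoc]
    exact sub_mem (basisSpan.smul_mem _ (Xdelta_mul_mem ih.1)) (basisSpan.smul_mem _ ih.2)

theorem XO_mul_mem (m : ℤ) {x : CompletedTorus} (hx : x ∈ basisSpan) : XO m * x ∈ basisSpan := by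
  induction hx using Submodule.span_induction with
  | zero => rw [mul_zero]; exact zero_mem _
  | add x y _ _ hx hy => rw [mul_add]; exact add_mem hx hy
  | smul c x _ hx => rw [mul_smul_comm]; exact basisSpan.smul_mem c hx
  | mem x hx =>
    rcases hx with hx | ⟨n, rfl⟩
    · obtain ⟨r, -, l, d, -, -, rfl⟩ := Set.mem_iUnion₂.mp hx
      refine XO_mul_mem_of_consecutive (l := l) ?_ ?_ m
      · rw [← mul_assoc, ← pow_succ']
        exact XO_pow_mul_XO_pow_mem l _ _
      · rw [← mul_assoc, XO_succ_mul_XO_pow, smul_mul_assoc, mul_assoc, ← pow_succ']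
        exact basisSpan.smul_mem _ (XO_pow_mul_XO_pow_mem l _ _)
    · exact XO_mul_Xdelta_pow_mem m n

/-- Stability under the generators suffices. Applied to `x = 1`, it shows that the span contains the
algebra. -/
theorem mul_mem_basisSpan {a x : CompletedTorus} (ha : a ∈ clusterAlgebra) (hx : x ∈ basisSpan) :
    a * x ∈ basisSpan := by
  induction ha using Algebra.adjoin_induction generalizing x with
  | mem a ha =>
    obtain ⟨m, rfl⟩ := ha
    exact XO_mul_mem m hx
  | algebraMap c =>
    rw [← Algebra.smul_def]
    exact basisSpan.smul_mem c hx
  | add a b _ _ ha hb => rw [add_mul]; exact add_mem (ha hx) (hb hx)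
  | mul a b _ _ ha hb => rw [mul_assoc]; exact ha (hb hx)

theorem Bvet_union_Btor_subset : Bvet ∪ Btor ⊆ (clusterAlgebra : Set CompletedTorus) := by
  have hX : ∀ l, XO l ∈ clusterAlgebra := fun l => Algebra.subset_adjoin ⟨l, rfl⟩
  rintro x (hx | ⟨n, rfl⟩)
  · obtain ⟨r, -, l, d, -, -, rfl⟩ := Set.mem_iUnion₂.mp hx
    exact mul_mem (pow_mem (hX l) d) (pow_mem (hX (l + 1)) _)
  · exact pow_mem Xdelta_mem n

theorem basisSpan_eq : basisSpan = Subalgebra.toSubmodule clusterAlgebra := by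
  refine le_antisymm (Submodule.span_le.mpr Bvet_union_Btor_subset) fun a ha => ?_
  have h := mul_mem_basisSpan ha (Xdelta_pow_mem_basisSpan 0)
  rwa [pow_zero, mul_one] at h

/-! ### Leading exponents and linear independence -/

/-- The exponent `β` precedes `α` when the second coordinates are compared first. -/
def LexLE (β α : Expo) : Prop := β 1 < α 1 ∨ (β 1 = α 1 ∧ β 0 ≤ α 0)

/-- `α` is the leading exponent of `f` for the lexicographic order. -/
def HasLead (f : CompletedTorus) (α : Expo) : Prop :=
  f.coeff α ≠ 0 ∧ ∀ β, f.coeff β ≠ 0 → LexLE β α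

/-- The order is compatible with addition, so only the two leading terms contribute at `α + β`;
their product survives because the coefficient ring is a domain and powers of ν are units. -/
theorem HasLead.mul {f g : CompletedTorus} {α β : Expo} (hf : HasLead f α) (hg : HasLead g β) :
    HasLead (f * g) (α + β) := by
  constructor
  · rw [coeff_mul, mulCoeff_eq_sum {α}]
    · rw [Finset.sum_singleton, add_sub_cancel_left]
      exact mul_ne_zero (mul_ne_zero (LaurentPolynomial.isUnit_T _).ne_zero hf.1) hg.1
    · intro γ h1 h2
      have h3 := hf.2 γ h1
      have h4 := hg.2 _ h2
      simp only [LexLE, Pi.add_apply, Pi.sub_apply] at h3 h4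
      rw [Finset.mem_singleton]
      ext i
      fin_cases i <;> simp <;> omega
  · intro γ hγ
    by_contra hc
    refine hγ ?_
    rw [coeff_mul, mulCoeff_eq_sum ∅, Finset.sum_empty]
    intro δ h1 h2
    have h3 := hf.2 δ h1
    have h4 := hg.2 _ h2
    simp only [LexLE, Pi.add_apply, Pi.sub_apply] at h3 h4 hc
    omega

theorem hasLead_one : HasLead 1 0 := by
  constructor
  · simp [coeff_one]
  · intro β hβ
    by_contra hc
    refine hβ (Pi.single_eq_of_ne ?_ _)
    rintro rfl
    exact hc (Or.inr ⟨rfl, le_rfl⟩)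

theorem HasLead.pow {f : CompletedTorus} {α : Expo} (hf : HasLead f α) (n : ℕ) :
    HasLead (f ^ n) (n • α) := by
  induction n with
  | zero => simpa using hasLead_one
  | succ n ih => rw [pow_succ, succ_nsmul]; exact ih.mul hf

theorem hasLead_XO (l : ℤ) : HasLead (XO l) ![-(l + 1), 1] := by
  rw [XO_eq]
  constructor
  · simp [coeff_monomial, coeff_ser]
  · intro β hβ
    by_contra hc
    refine hβ ?_
    rw [coeff_add, coeff_monomial, Pi.single_eq_of_ne, coeff_ser_ne, add_zero]
    · rintro k rfl
      simp [LexLE] at hc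
    · rintro rfl
      simp [LexLE] at hc

theorem hasLead_Xdelta : HasLead Xdelta ![1, 0] := by
  rw [Xdelta_eq]
  constructor
  · simp [coeff_monomial]
  · intro β hβ
    by_contra hc
    refine hβ ?_
    rw [coeff_add, coeff_monomial, coeff_monomial, Pi.single_eq_of_ne, Pi.single_eq_of_ne, add_zero]
    · rintro rfl
      simp [LexLE] at hc
    · rintro rfl
      simp [LexLE] at hc

/-- Series with distinct leading exponents are linearly independent. -/
theorem linearIndependent_of_hasLead {ι : Type*} (v : ι → CompletedTorus) (lead : ι → Expo)
    (hv : ∀ i, HasLead (v i) (lead i)) (hinj : Function.Injective lead) :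
    LinearIndependent Coeff v := by
  classical
  rw [linearIndependent_iff']
  intro s c hc i hi
  by_contra hci
  let key : ι → ℤ ×ₗ ℤ := fun j => toLex (lead j 1, lead j 0)
  -- Among the terms with nonzero coefficient, the one with the largest leading exponent is the only
  -- one seen at that exponent.
  obtain ⟨j, hj, hmax⟩ := (s.filter fun j => c j ≠ 0).exists_max_image key
    ⟨i, Finset.mem_filter.mpr ⟨hi, hci⟩⟩
  rw [Finset.mem_filter] at hj
  let ev : CompletedTorus →ₗ[Coeff] Coeff :=
    { toFun := fun f => f.coeff (lead j)
      map_add' := fun _ _ => rfl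
      map_smul' := fun _ _ => rfl }
  have h := congrArg ev hc
  rw [map_sum, map_zero, Finset.sum_eq_single_of_mem j hj.1] at h
  · rw [map_smul, smul_eq_mul] at h
    exact mul_ne_zero hj.2 (hv j).1 h
  · intro k hk hkj
    rw [map_smul, smul_eq_mul]
    by_contra hne
    have h1 := hmax k (Finset.mem_filter.mpr ⟨hk, left_ne_zero_of_mul hne⟩)
    have h2 := (hv k).2 _ (right_ne_zero_of_mul hne)
    rw [Prod.Lex.toLex_le_toLex] at h1
    simp only [LexLE] at h1 h2
    refine hkj (hinj ?_)
    ext a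
    fin_cases a <;> simp <;> omega

/-- Cluster monomials `X_{𝒪(l)} ^ (d + 1) X_{𝒪(l+1)} ^ e`, and powers of `X_δ`. -/
noncomputable def basisFamily : (ℤ × ℕ × ℕ) ⊕ ℕ → CompletedTorus :=
  Sum.elim (fun p => XO p.1 ^ (p.2.1 + 1) * XO (p.1 + 1) ^ p.2.2) (fun n => Xdelta ^ n)

/-- Leading exponents of `basisFamily`. -/
def basisLead : (ℤ × ℕ × ℕ) ⊕ ℕ → Expo :=
  Sum.elim (fun p => (p.2.1 + 1) • ![-(p.1 + 1), 1] + p.2.2 • ![-(p.1 + 1 + 1), 1])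
    (fun n => n • ![1, 0])

theorem hasLead_basisFamily (i : (ℤ × ℕ × ℕ) ⊕ ℕ) : HasLead (basisFamily i) (basisLead i) := by
  rcases i with ⟨l, d, e⟩ | n
  · exact ((hasLead_XO l).pow _).mul ((hasLead_XO (l + 1)).pow _)
  · exact hasLead_Xdelta.pow n

/-- With r = d + 1 + e the leading exponent is (-(r(l+1) + e), r), and 0 ≤ e < r: thus l + 1 and e
are the quotient and remainder of a division by r. Powers of `Xdelta` occupy row 0, which cluster
monomials avoid since r ≥ 1. -/
theorem basisLead_injective : Function.Injective basisLead := by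
  rintro (⟨l, d, e⟩ | n) (⟨l', d', e'⟩ | n') h
  all_goals
    have h0 := congrFun h 0
    have h1 := congrFun h 1
    simp [basisLead] at h0 h1
  · have hr : (d : ℤ) + 1 + e = d' + 1 + e' := h1
    have hk : (l' - l) * (d + 1 + e) = e - e' := by linear_combination h0 + (l' + 1) * hr
    -- Both remainders are smaller than the common r, so their difference is a multiple of r only if
    -- it vanishes.
    have hl : l = l' := by
      rcases lt_trichotomy l l' with hlt | heq | hgt
      · nlinarith
      · exact heq
      · nlinarith
    subst hl
    have he : (e : ℤ) = e' := by linear_combination -hk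
    have he' : e = e' := by exact_mod_cast he
    have hd' : d = d' := by omega
    rw [he', hd']
  · omega
  · omega
  · rw [h0]

theorem range_basisFamily : Set.range basisFamily = Bvet ∪ Btor := by
  ext x
  constructor
  · rintro ⟨⟨l, d, e⟩ | n, rfl⟩
    · exact Or.inl (XO_pow_mul_XO_pow_mem_Bvet l d e)
    · exact Or.inr ⟨n, rfl⟩
  · rintro (hx | ⟨n, rfl⟩)
    · obtain ⟨r, -, l, d, hd, -, rfl⟩ := Set.mem_iUnion₂.mp hx
      refine ⟨Sum.inl (l, d - 1, r - d), ?_⟩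
      simp [basisFamily, Nat.sub_add_cancel hd]
    · exact ⟨Sum.inr n, rfl⟩

theorem linearIndependent_Bvet_union_Btor :
    LinearIndependent Coeff (fun x : ↥(Bvet ∪ Btor) => (x : CompletedTorus)) := by
  have h := (linearIndependent_of_hasLead _ _ hasLead_basisFamily
    basisLead_injective).linearIndepOn_id
  rw [range_basisFamily] at h
  exact h

end QuantumP1

/-! ### The basis theorem -/

theorem theorem5p15 :
    ∃ b : Module.Basis ↥(QuantumP1.Bvet ∪ QuantumP1.Btor) QuantumP1.Coeff
        ↥QuantumP1.clusterAlgebra,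
      ∀ x : ↥(QuantumP1.Bvet ∪ QuantumP1.Btor),
        (b x : QuantumP1.CompletedTorus) = (x : QuantumP1.CompletedTorus) := by
  let v : ↥(QuantumP1.Bvet ∪ QuantumP1.Btor) → ↥QuantumP1.clusterAlgebra :=
    fun x => ⟨x, QuantumP1.Bvet_union_Btor_subset x.2⟩
  have hv : LinearIndependent QuantumP1.Coeff v :=
    LinearIndependent.of_comp (Subalgebra.toSubmodule QuantumP1.clusterAlgebra).subtype
      QuantumP1.linearIndependent_Bvet_union_Btor
  have hspan : ⊤ ≤ Submodule.span QuantumP1.Coeff (Set.range v) := by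
    rintro ⟨a, ha⟩ -
    rw [← Subalgebra.mem_toSubmodule, ← QuantumP1.basisSpan_eq] at ha
    -- The span was computed in the torus; writing it as the image of a span under the inclusion
    -- brings it back inside the algebra.
    have hr : (Subalgebra.toSubmodule QuantumP1.clusterAlgebra).subtype '' Set.range v =
        QuantumP1.Bvet ∪ QuantumP1.Btor := by
      rw [← Set.range_comp]
      exact Subtype.range_coe
    rw [QuantumP1.basisSpan, ← hr, Submodule.span_image] at ha
    obtain ⟨y, hy, rfl⟩ := ha
    exact hy
  exact ⟨Module.Basis.mk hv hspan, fun x => by rw [Module.Basis.mk_apply]⟩
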